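/- Conventions. For a real $n\times m$ matrix $X$ and $r\ge 1$, the $r$-th compound $X_{[r]}$ is the matrix of all $r$-minors of $X$, rows and columns being indexed by the strictly increasing $r$-tuples of row and column indices. $X$ is called $k$-positive if $k\le\min\{n,m\}$ and $X_{[j]}\ge 0$ entrywise for $1\le j\le k$. For $A\in\mathbb{R}^{K\times K}$, a column vector $b\in\mathbb{R}^K$ and a row vector $c$ of length $K$ put $$\mathcal{C}^j(A,b)=\begin{pmatrix} b & Ab & \cdots & A^{j-1}b\end{pmatrix},\qquad \mathcal{O}^j(A,c)=\mathcal{C}^j(A^{\mathsf T},c^{\mathsf T})^{\mathsf T}.$$ A triple $(A,b,c)$ is a realization of the real rational function $G(z)$ if $G(z)=\sum_{t\ge 1} cA^{t-1}b\,z^{-t}$ for all complex $z$ of sufficiently large modulus. The poles $p_1,p_2,\dots,p_n$ of $G$ are the complex roots of its denominator in lowest terms, counted with multiplicity and listed by decreasing modulus and, for equal modulus, by decreasing real part; their number $n$ is the order of the system. Theorem. Let $k\ge 1$ and let $(A,b,c)$ be a realization of $G(z)$ such that $A\in\mathbb{R}^{K\times K}$ is $k$-positive. Then: (i) If $\mathcal{C}^j(A,b)_{[j]}\ge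 0$ for $1\le j\le k$ and $\operatorname{rank}\bigl(A^{K-j}\mathcal{C}^j(A,b)\bigr)=j$ for all $1\le j\le k-1$, then $\mathcal{C}^t(A,b)$ is $k$-positive for all $t\ge k$. (ii) If $\mathcal{O}^j(A,c)_{[j]}\ge 0$ for $1\le j\le k$ and $\operatorname{rank}\bigl(\mathcal{O}^j(A,c)A^{K-j}\bigr)=j$ for all $1\le j\le k-1$, then $\mathcal{O}^t(A,c)$ is $k$-positive for all $t\ge k$. (iii) If $k\le n$ and $p_{k-1}$ is real and positive (no condition on the poles when $k=1$), then the rank conditions in (i) and in (ii) both hold. -/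

import Mathlib

namespace HankelPos

/-- The `r`-th multiplicative compound of an `n × m` matrix: its entries are the `r`-minors of `X`.
Rows and columns are indexed by the strictly increasing `r`-tuples `v₁ < ⋯ < vᵣ` of indices. -/
def compound {n m : ℕ} (X : Matrix (Fin n) (Fin m) ℝ) (r : ℕ) :
    Matrix (Fin r ↪o Fin n) (Fin r ↪o Fin m) ℝ :=
  Matrix.of fun I J => (X.submatrix I J).det

/-- Entrywise nonnegativity of a real matrix. -/
def Nonneg {ι κ : Type*} (X : Matrix ι κ ℝ) : Prop :=
  ∀ i j, 0 ≤ X i j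

/-- `X ∈ ℝ^{n × m}` is `k`-positive: `k ≤ min n m` and all compounds of order `1 ≤ j ≤ k` are
entrywise nonnegative. -/
def IsKPositive {n m : ℕ} (k : ℕ) (X : Matrix (Fin n) (Fin m) ℝ) : Prop :=
  k ≤ min n m ∧ ∀ j, 1 ≤ j → j ≤ k → Nonneg (compound X j)

/-- The truncated controllability matrix `(b, A b, …, A^{j-1} b)`. -/
def ctrb {K : ℕ} (j : ℕ) (A : Matrix (Fin K) (Fin K) ℝ) (b : Fin K → ℝ) :
    Matrix (Fin K) (Fin j) ℝ :=
  Matrix.of fun i t => ((A ^ (t : ℕ)).mulVec b) i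

/-- The truncated observability matrix, with rows `c, c A, …, c A^{j-1}`. -/
def obsv {K : ℕ} (j : ℕ) (A : Matrix (Fin K) (Fin K) ℝ) (c : Fin K → ℝ) :
    Matrix (Fin j) (Fin K) ℝ :=
  (ctrb j A.transpose c).transpose

/-- The impulse response of `x(t+1) = A x(t) + b u(t)`, `y(t) = c x(t)`:
`g(0) = 0` and `g(t) = c A^{t-1} b` for `t ≥ 1`. -/
def impulseResponse {K : ℕ} (A : Matrix (Fin K) (Fin K) ℝ) (b c : Fin K → ℝ) : ℕ → ℝ
  | 0 => 0
  | t + 1 => c ⬝ᵥ ((A ^ t).mulVec b)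

/-- `(A, b, c)` realizes the transfer function `G`: `G(z) = ∑_{t ≥ 0} g(t) z^{-t}` for all complex
`z` of sufficiently large modulus, where `g` is the impulse response of `(A, b, c)`. -/
def IsRealization {K : ℕ} (A : Matrix (Fin K) (Fin K) ℝ) (b c : Fin K → ℝ)
    (G : RatFunc ℝ) : Prop :=
  ∀ᶠ z : ℂ in Bornology.cobounded ℂ,
    HasSum (fun t : ℕ => (impulseResponse A b c t : ℂ) * (z ^ t)⁻¹)
      (RatFunc.eval (algebraMap ℝ ℂ) z G)

/-- The poles of `G` with multiplicity: complex roots of the denominator in lowest terms. -/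
noncomputable def poles (G : RatFunc ℝ) : Multiset ℂ :=
  (G.denom.map (algebraMap ℝ ℂ)).roots

/-- The order of the system: its number of poles, counted with multiplicity. -/
noncomputable def order (G : RatFunc ℝ) : ℕ :=
  (poles G).card

/-- `p` lists all poles of `G` with multiplicity, by decreasing modulus and, for equal modulus,
by decreasing real part. The index is zero-based: `p i` is the pole written `p_{i+1}`. -/
def IsPoleListing (G : RatFunc ℝ) (p : Fin (order G) → ℂ) : Prop :=
  Multiset.map p Finset.univ.val = poles G ∧
    ∀ i j, i < j → ‖p j‖ < ‖p i‖ ∨ (‖p j‖ = ‖p i‖ ∧ (p j).re ≤ (p i).re)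

end HankelPos

/-! The minors of `C = (b, A b, A² b, …)` of order at most `k` are nonnegative by induction on the
order `r` and, for fixed order, on the spread of the column set.

A minor on `r` consecutive columns starting at `s` is a maximal minor of `Aˢ (b, …, Aʳ⁻¹ b)`, and
Cauchy–Binet (`Matrix.det_mul_eq_sum_orderEmb`) gives its sign. For a column set `J` with extremes
`a < c` and a gap, the Plücker relation (`Matrix.three_term_plucker`)
`D(S, p) φ(a, S, c) = D(a, S) φ(S, p, c) + D(S, c) φ(a, S, p)`, with `J = {a} ∪ S ∪ {c}` and `p`
between `a` and `c`, expresses the minor `φ` at `J` by minors `φ` of smaller spread and by minors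
`D` of order `r - 1`. Only the pivot `D(S, p)` has to be positive, not merely nonnegative. For this
two things suffice. First, `C` is multiplied on the left by the Gaussian kernel `x ^ (i - j) ^ 2`,
all minors of which are positive, so that a maximal minor becomes positive as soon as the columns
are independent; letting `x → 0` recovers `C` (`det_nonneg_of_exchange`). Second, if the columns `J`
are independent, some `p` makes `S ∪ {p}` independent: otherwise all `Aᵖ b` with `a < p < c` lie in
the span of `S`, whose dimension is too small for them to be independent, so a Krylov subspace
inside that span is `A`-invariant and contains the column `c`, contradicting independence
(`exists_notMem_of_orbit`). When the columns `J` are dependent the minor is zero.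

The observability statement follows by transposition. For the rank conditions, a linear relation
among the columns of `Aᵉ (b, …, Aʲ⁻¹ b)` is a polynomial `P = zᵉ q` with `deg q < j` and
`P(A) b = 0`; then `P G` is a polynomial, the denominator of `G` divides `P`
(`HankelPos.IsRealization.denom_dvd`), and `G` has fewer than `j` nonzero poles. This is impossible
for `j ≤ k - 1` if `p_{k-1} ≠ 0`, as the earlier poles have at least its modulus. -/

section

open Matrix Finset

/-! ### The Cauchy–Binet formula -/

/-- Expansion of `det (A * B)` by multilinearity in the rows. -/
theorem Matrix.det_mul_eq_sum_fun {R : Type*} [CommRing R] {r n : ℕ}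
    (A : Matrix (Fin r) (Fin n) R) (B : Matrix (Fin n) (Fin r) R) :
    (A * B).det = ∑ g : Fin r → Fin n, (∏ i, A i (g i)) * (B.submatrix g id).det := by
  have h1 : (A * B).det = Matrix.detRowAlternating (fun i => ∑ l, A i l • B l) := by
    rw [Matrix.detRowAlternating]
    congr 1
    ext i j
    simp [Matrix.mul_apply, Finset.sum_apply]
  rw [h1, ← AlternatingMap.coe_multilinearMap, MultilinearMap.map_sum]
  refine Finset.sum_congr rfl fun g _ => ?_
  rw [MultilinearMap.map_smul_univ]
  rfl

/-- The **Cauchy–Binet formula**: a minor of a product is the sum, over all increasing selections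
of the inner index, of the products of the minors of the factors. -/
theorem Matrix.det_mul_eq_sum_orderEmb {R : Type*} [CommRing R] {r n : ℕ}
    (A : Matrix (Fin r) (Fin n) R) (B : Matrix (Fin n) (Fin r) R) :
    (A * B).det =
      ∑ L : Fin r ↪o Fin n, (A.submatrix id L).det * (B.submatrix L id).det := by
  have h2 : ∀ L : Fin r ↪o Fin n, (A.submatrix id L).det * (B.submatrix L id).det =
      ∑ σ : Equiv.Perm (Fin r), (∏ i, A i (L (σ i))) * (B.submatrix (L ∘ σ) id).det := by
    intro L
    rw [← Matrix.det_transpose, Matrix.det_apply', Finset.sum_mul]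
    refine Finset.sum_congr rfl fun σ _ => ?_
    have h3 : B.submatrix (L ∘ σ) id = (B.submatrix L id).submatrix σ id := rfl
    rw [h3, Matrix.det_permute]
    simp only [transpose_apply, submatrix_apply, id]
    ring
  rw [Matrix.det_mul_eq_sum_fun, Finset.sum_congr rfl fun L _ => h2 L,
    ← Fintype.sum_prod_type']
  symm
  refine Finset.sum_of_injOn (fun x : (Fin r ↪o Fin n) × Equiv.Perm (Fin r) => x.1 ∘ x.2)
    ?_ (by simp) ?_ (fun _ _ => rfl)
  · rintro ⟨L, σ⟩ - ⟨L', σ'⟩ - h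
    have hr : Set.range L = Set.range L' := by
      have := congrArg Set.range h
      simpa [Set.range_comp, σ.surjective.range_eq, σ'.surjective.range_eq] using this
    have hL : L = L' := by
      apply DFunLike.coe_injective
      exact (StrictMono.range_inj L.strictMono L'.strictMono).1 hr
    subst hL
    have : σ = σ' := by
      refine Equiv.ext fun i => ?_
      have := congrFun h i
      simpa using this
    rw [this]
  · intro g _ hg
    by_cases hinj : Function.Injective g
    · exfalso
      apply hg
      have hc : (Finset.univ.image g).card = r := by
        rw [Finset.card_image_of_injective _ hinj]; simp
      have hmem : ∀ i, ∃ j, (Finset.univ.image g).orderEmbOfFin hc j = g i := by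
        intro i
        have : g i ∈ Set.range ((Finset.univ.image g).orderEmbOfFin hc) := by
          rw [Finset.range_orderEmbOfFin]; simp
        exact this
      choose s hs using hmem
      have hsinj : Function.Injective s := by
        intro i j hij
        apply hinj
        rw [← hs, ← hs, hij]
      refine ⟨⟨(Finset.univ.image g).orderEmbOfFin hc,
        Equiv.ofBijective s (Finite.injective_iff_bijective.1 hsinj)⟩, by simp, ?_⟩
      funext i
      simp [hs]
    · rw [Function.not_injective_iff] at hinj
      obtain ⟨i, j, hij, hne⟩ := hinj
      rw [Matrix.det_zero_of_row_eq hne, mul_zero]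
      ext l
      simp [hij]

/-! ### A three-term Plücker relation -/

/-- Cramer's rule for `r + 1` vectors in dimension `r`: the alternating sum of the columns, each
weighted by the determinant of the remaining ones, vanishes. -/
theorem Matrix.sum_det_submatrix_succAbove_mul_eq_zero {R : Type*} [CommRing R] {r : ℕ}
    (M : Matrix (Fin r) (Fin (r + 1)) R) (l : Fin r) :
    ∑ i : Fin (r + 1), (-1) ^ (i : ℕ) * M l i * (M.submatrix id i.succAbove).det = 0 := by
  have h : (Matrix.of (Fin.cons (M l) M : Fin (r + 1) → Fin (r + 1) → R)).det = 0 :=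
    Matrix.det_zero_of_row_eq (i := 0) (j := l.succ) (Fin.succ_ne_zero l).symm
      rfl
  rw [Matrix.det_succ_row_zero] at h
  exact h

/-- The linear functional `x ↦ det (x, S)` evaluated at a column of the matrix itself. -/
theorem Matrix.sum_mul_det_submatrix_succAbove {R : Type*} [CommRing R] {r n : ℕ}
    (N : Matrix (Fin (r + 1)) (Fin n) R) (S : Fin (r + 1) → Fin n) (m : Fin (r + 1)) :
    ∑ l : Fin (r + 1), (-1) ^ (l : ℕ) * N l (S m) *
        (N.submatrix l.succAbove (S ∘ m.succAbove)).det =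
      (-1) ^ (m : ℕ) * (N.submatrix id S).det := by
  rw [Matrix.det_succ_column (N.submatrix id S) m, Finset.mul_sum]
  refine Finset.sum_congr rfl fun l _ => ?_
  have h : ((-1 : R)) ^ (m : ℕ) * (-1) ^ (m : ℕ) = 1 := by
    rw [← mul_pow]; simp
  simp only [submatrix_apply, id, submatrix_submatrix, Function.id_comp, pow_add]
  linear_combination (-((-1) ^ (l : ℕ) * N l (S m) *
        (N.submatrix l.succAbove (S ∘ m.succAbove)).det)) * h

/-- Three-term Plücker relation between the minors of order `r + 2` and, after deletion of the
first row, those of order `r + 1`. Of the `r + 3` columns, `0` and the last one are `a` and `c`,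
the column `m.castSucc.succ` is `p`, and `S` collects the remaining `r` columns; the relation reads
`D(S, p) φ(a, S, c) = D(a, S) φ(S, p, c) + D(S, c) φ(a, S, p)`. -/
theorem Matrix.three_term_plucker {R : Type*} [CommRing R] {r : ℕ}
    (M : Matrix (Fin (r + 2)) (Fin (r + 3)) R) (m : Fin (r + 1)) :
    (M.submatrix Fin.succ (fun j : Fin (r + 1) => j.castSucc.succ)).det *
        (M.submatrix id m.castSucc.succ.succAbove).det =
      (M.submatrix Fin.succ
          (Fin.cons 0 (fun j : Fin r => (m.succAbove j).castSucc.succ))).det *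
        (M.submatrix id Fin.succ).det +
      (M.submatrix Fin.succ
          (Fin.snoc (fun j : Fin r => (m.succAbove j).castSucc.succ) (Fin.last (r + 2)))).det *
        (M.submatrix id Fin.castSucc).det := by
  set e : Fin (r + 1) → Fin (r + 3) := fun j => j.castSucc.succ with he
  set N : Matrix (Fin (r + 1)) (Fin (r + 3)) R := M.submatrix Fin.succ id with hN
  set ψ : Fin (r + 3) → R := fun i => ∑ l : Fin (r + 1), (-1) ^ (l : ℕ) * N l i *
        (N.submatrix l.succAbove (e ∘ m.succAbove)).det with hψ
  have h0 : ∑ i : Fin (r + 3), (-1) ^ (i : ℕ) * ψ i * (M.submatrix id i.succAbove).det = 0 := by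
    have : ∀ l : Fin (r + 1), (-1) ^ (l : ℕ) * (N.submatrix l.succAbove (e ∘ m.succAbove)).det *
      ∑ i : Fin (r + 3), (-1) ^ (i : ℕ) * M l.succ i * (M.submatrix id i.succAbove).det = 0 := by
      intro l
      rw [Matrix.sum_det_submatrix_succAbove_mul_eq_zero, mul_zero]
    rw [← Finset.sum_eq_zero (s := Finset.univ) fun l _ => this l]
    simp only [hψ, Finset.mul_sum, Finset.sum_mul]
    rw [Finset.sum_comm]
    refine Finset.sum_congr rfl fun l _ => Finset.sum_congr rfl fun i _ => ?_
    simp only [hN, submatrix_apply, id]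
    ring
  have hp : ψ (e m) = (-1) ^ (m : ℕ) * (N.submatrix id e).det :=
    Matrix.sum_mul_det_submatrix_succAbove N e m
  have ha : ψ 0 = (N.submatrix id (Fin.cons 0 (e ∘ m.succAbove))).det := by
    have := Matrix.sum_mul_det_submatrix_succAbove N (Fin.cons 0 (e ∘ m.succAbove)) 0
    simpa [hψ, Function.comp_def] using this
  have hc : ψ (Fin.last (r + 2)) = (-1) ^ r *
      (N.submatrix id (Fin.snoc (e ∘ m.succAbove) (Fin.last (r + 2)))).det := by
    have := Matrix.sum_mul_det_submatrix_succAbove N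
      (Fin.snoc (e ∘ m.succAbove) (Fin.last (r + 2)) : Fin (r + 1) → Fin (r + 3)) (Fin.last r)
    simpa [hψ, Function.comp_def] using this
  -- the functional `ψ` vanishes on the columns in `S`, since a column is then repeated
  have hS : ∀ t : Fin r, ψ (e (m.succAbove t)) = 0 := by
    intro t
    have := Matrix.sum_mul_det_submatrix_succAbove N
      (Fin.cons (e (m.succAbove t)) (e ∘ m.succAbove)) 0
    rw [Matrix.det_zero_of_column_eq (i := 0) (j := t.succ) (Fin.succ_ne_zero t).symm
      (by intro l; simp)] at this
    simpa [hψ, Function.comp_def] using this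
  rw [Fin.sum_univ_succ, Fin.sum_univ_castSucc, Fin.sum_univ_succAbove _ m] at h0
  have h1 : ∀ t : Fin r, ψ ((m.succAbove t).castSucc.succ) = 0 := hS
  have hp' : ψ (m.castSucc.succ) = (-1) ^ (m : ℕ) * (N.submatrix id e).det := hp
  simp only [h1, hp', ha, Fin.succ_last, hc] at h0
  have hm : ((-1 : R)) ^ (m : ℕ) * (-1) ^ (m : ℕ) = 1 := by
    rw [← mul_pow]; simp
  have hr : ((-1 : R)) ^ r * (-1) ^ r = 1 := by
    rw [← mul_pow]; simp
  simp only [hN, submatrix_submatrix, Function.comp_id, Fin.val_zero, Fin.val_succ,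
    Fin.val_castSucc, Fin.val_last, Fin.succAbove_zero, Fin.succAbove_last, mul_zero, zero_mul,
    Finset.sum_const_zero, add_zero, pow_succ, pow_zero, one_mul, Function.id_comp] at h0
  have ec : (e ∘ m.succAbove) = fun j : Fin r => (m.succAbove j).castSucc.succ := rfl
  rw [ec] at h0
  linear_combination -h0 - ((M.submatrix Fin.succ e).det *
        (M.submatrix id m.castSucc.succ.succAbove).det) * hm + ((M.submatrix Fin.succ
          (Fin.snoc (fun j : Fin r => (m.succAbove j).castSucc.succ) (Fin.last (r + 2)))).det *
        (M.submatrix id Fin.castSucc).det) * hr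

/-! ### Filling gaps in column sets -/

/-- A value strictly between the extremes of an increasing tuple and missed by it can be inserted,
at an interior position. -/
theorem exists_strictMono_insert {r : ℕ} {J : Fin (r + 2) → ℕ} (hJ : StrictMono J) {p : ℕ}
    (h0 : J 0 < p) (h1 : p < J (Fin.last (r + 1))) (hp : p ∉ Set.range J) :
    ∃ (f : Fin (r + 3) → ℕ) (m : Fin (r + 1)), StrictMono f ∧ f m.castSucc.succ = p ∧
      f ∘ m.castSucc.succ.succAbove = J := by
  have hp' : p ∉ Finset.univ.image J := by simpa using hp
  have hc : (insert p (Finset.univ.image J)).card = r + 3 := by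
    rw [Finset.card_insert_of_notMem hp', Finset.card_image_of_injective _ hJ.injective]
    simp
  set f := (insert p (Finset.univ.image J)).orderEmbOfFin hc with hf
  have hrange : Set.range f = insert p (Set.range J) := by
    rw [hf, Finset.range_orderEmbOfFin]; simp
  obtain ⟨q, hq⟩ : p ∈ Set.range f := by rw [hrange]; simp
  have hfq : f ∘ q.succAbove = J := by
    refine (StrictMono.range_inj (f.strictMono.comp (Fin.strictMono_succAbove q)) hJ).1 ?_
    rw [Set.range_comp, Fin.range_succAbove]
    have : f '' {q}ᶜ = Set.range f \ {p} := by
      rw [← Set.range_sdiff_image f.injective, Set.image_singleton, hq]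
    rw [this, hrange]
    exact Set.insert_sdiff_self_of_notMem hp
  have hq0 : q ≠ 0 := by
    rintro rfl
    have : J 0 = f (Fin.succ 0) := by rw [← hfq]; simp
    have h2 : f 0 < f (Fin.succ 0) := f.strictMono (Fin.succ_pos 0)
    omega
  obtain ⟨q', rfl⟩ := Fin.exists_succ_eq.2 hq0
  have hq1 : q' ≠ Fin.last (r + 1) := by
    rintro rfl
    have : J (Fin.last (r + 1)) = f (Fin.castSucc (Fin.last (r + 1))) := by
      rw [← hfq]; simp
    have h2 : f (Fin.castSucc (Fin.last (r + 1))) < f (Fin.last (r + 1)).succ :=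
      f.strictMono Fin.castSucc_lt_succ
    omega
  obtain ⟨m, rfl⟩ := Fin.exists_castSucc_eq.2 hq1
  exact ⟨f, m, f.strictMono, hq, hfq⟩

/-- Induction on the spread `J (last) - J 0` of an increasing tuple: a property holds for all tuples
once it holds for runs of consecutive numbers and, for every other tuple, either holds outright or
passes from the two tuples obtained by exchanging an endpoint for some interior missing number. -/
theorem spread_induction {r : ℕ} {P : (Fin (r + 2) → ℕ) → Prop}
    (hcons : ∀ s : ℕ, P fun j => s + j)
    (hstep : ∀ J : Fin (r + 2) → ℕ, StrictMono J → J 0 + (r + 1) < J (Fin.last (r + 1)) →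
      P J ∨ ∃ p, J 0 < p ∧ p < J (Fin.last (r + 1)) ∧ p ∉ Set.range J ∧
        ∀ (f : Fin (r + 3) → ℕ) (m : Fin (r + 1)), StrictMono f → f m.castSucc.succ = p →
          f ∘ m.castSucc.succ.succAbove = J → P (f ∘ Fin.succ) → P (f ∘ Fin.castSucc) → P J)
    (J : Fin (r + 2) → ℕ) (hJ : StrictMono J) : P J := by
  induction hd : J (Fin.last (r + 1)) - J 0 using Nat.strong_induction_on generalizing J with
  | _ d ih =>
  have hge : ∀ i : Fin (r + 2), J 0 + i ≤ J i := by
    intro i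
    induction i using Fin.induction with
    | zero => simp
    | succ i hi =>
      have := hJ (Fin.castSucc_lt_succ (i := i))
      simp only [Fin.val_succ, Fin.val_castSucc] at *
      omega
  have hle : ∀ i : Fin (r + 2), J i + (r + 1 - i) ≤ J (Fin.last (r + 1)) := by
    intro i
    induction i using Fin.reverseInduction with
    | last => simp
    | cast i hi =>
      have := hJ (Fin.castSucc_lt_succ (i := i))
      simp only [Fin.val_succ, Fin.val_castSucc] at *
      omega
  by_cases hlt : J 0 + (r + 1) < J (Fin.last (r + 1))
  · rcases hstep J hJ hlt with h | ⟨p, hp0, hp1, hp, h⟩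
    · exact h
    · obtain ⟨f, m, hf, hfp, hfJ⟩ := exists_strictMono_insert hJ hp0 hp1 hp
      have hf0 : f 0 = J 0 := by rw [← hfJ]; simp
      have hf1 : f (Fin.last (r + 2)) = J (Fin.last (r + 1)) := by
        rw [← hfJ, Function.comp_apply, Fin.succAbove_ne_last_last]
        rw [Ne, ← Fin.succ_last, Fin.succ_inj]
        exact Fin.castSucc_ne_last m
      have h2 : f 0 < f (Fin.succ 0) := hf (Fin.succ_pos 0)
      have h3 : f (Fin.succ 0) ≤ f (Fin.last (r + 2)) := hf.monotone (Fin.le_last _)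
      have h4 : f (Fin.castSucc (Fin.last (r + 1))) < f (Fin.last (r + 2)) :=
        hf Fin.castSucc_lt_succ
      have h5 : f 0 ≤ f (Fin.castSucc (Fin.last (r + 1))) := hf.monotone (Fin.zero_le _)
      refine h f m hf hfp hfJ (ih _ ?_ _ (hf.comp (Fin.strictMono_succ)) rfl)
        (ih _ ?_ _ (hf.comp (Fin.strictMono_castSucc)) rfl)
      · change f (Fin.last (r + 2)) - f (Fin.succ 0) < d
        omega
      · change f (Fin.castSucc (Fin.last (r + 1))) - f 0 < d
        omega
  · have : J = fun j : Fin (r + 2) => J 0 + (j : ℕ) := by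
      funext j
      have h1 := hge j
      have h2 := hle j
      have := j.2
      omega
    rw [this]
    exact hcons _

/-- The three-term Plücker relation for a matrix whose columns are selected by an increasing
tuple, together with the fact that all the tuples which occur in it are increasing. -/
theorem exchange_plucker {n r : ℕ} (W : Matrix (Fin n) ℕ ℝ) (I : Fin (r + 2) → Fin n)
    {f : Fin (r + 3) → ℕ} (hf : StrictMono f) (m : Fin (r + 1)) :
    ∃ J₁ J₂ : Fin (r + 1) → ℕ, StrictMono J₁ ∧ StrictMono J₂ ∧
      (W.submatrix (I ∘ Fin.succ) (fun j => f j.castSucc.succ)).det *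
          (W.submatrix I (f ∘ m.castSucc.succ.succAbove)).det =
        (W.submatrix (I ∘ Fin.succ) J₁).det * (W.submatrix I (f ∘ Fin.succ)).det +
        (W.submatrix (I ∘ Fin.succ) J₂).det * (W.submatrix I (f ∘ Fin.castSucc)).det := by
  refine ⟨f ∘ Fin.cons 0 (fun j : Fin r => (m.succAbove j).castSucc.succ),
    f ∘ Fin.snoc (fun j : Fin r => (m.succAbove j).castSucc.succ) (Fin.last (r + 2)),
    hf.comp ?_, hf.comp ?_, Matrix.three_term_plucker (W.submatrix I f) m⟩
  · refine Fin.strictMono_iff_lt_succ.2 ?_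
    have hs : StrictMono fun j : Fin r => (m.succAbove j).castSucc.succ :=
      (Fin.strictMono_succ.comp Fin.strictMono_castSucc).comp (Fin.strictMono_succAbove m)
    intro i
    cases r with
    | zero => exact i.elim0
    | succ r =>
      induction i using Fin.cases with
      | zero => simp [Fin.lt_def]
      | succ i =>
        rw [← Fin.succ_castSucc, Fin.cons_succ, Fin.cons_succ]
        exact hs Fin.castSucc_lt_succ
  · refine Fin.strictMono_iff_lt_succ.2 ?_
    have hs : StrictMono fun j : Fin r => (m.succAbove j).castSucc.succ :=
      (Fin.strictMono_succ.comp Fin.strictMono_castSucc).comp (Fin.strictMono_succAbove m)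
    intro i
    rw [Fin.snoc_castSucc]
    cases r with
    | zero => exact i.elim0
    | succ r =>
      induction i using Fin.lastCases with
      | last =>
        rw [Fin.succ_last, Fin.snoc_last]
        simp [Fin.lt_def]
      | cast i =>
        rw [show (Fin.castSucc i).succ = i.succ.castSucc from rfl, Fin.snoc_castSucc]
        exact hs Fin.castSucc_lt_succ

/-! ### Strict total positivity of the Gaussian kernel -/

/-- Generalized Vandermonde determinants with increasing positive nodes and increasing exponents
are positive. -/
theorem det_pow_pos {n : ℕ} {x : Fin n → ℝ} (hx : StrictMono x) (hx0 : ∀ i, 0 < x i) (r : ℕ)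
    (I : Fin r → Fin n) (J : Fin r → ℕ) (hI : StrictMono I) (hJ : StrictMono J) :
    0 < ((Matrix.of fun i (s : ℕ) => x i ^ s).submatrix I J).det := by
  induction r with
  | zero => simp
  | succ r ih =>
  cases r with
  | zero => simpa using pow_pos (hx0 _) _
  | succ r =>
  revert I
  refine spread_induction (P := fun J => ∀ I : Fin (r + 2) → Fin n, StrictMono I →
    0 < ((Matrix.of fun i (s : ℕ) => x i ^ s).submatrix I J).det) ?_ ?_ J hJ
  · intro s I hI
    have : (Matrix.of fun i (s : ℕ) => x i ^ s).submatrix I (fun j : Fin (r + 2) => s + (j : ℕ)) =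
        Matrix.of fun i j => x (I i) ^ s * Matrix.vandermonde (x ∘ I) i j := by
      ext i j
      simp [Matrix.vandermonde_apply, pow_add]
    rw [this, Matrix.det_mul_column, Matrix.det_vandermonde]
    refine mul_pos (Finset.prod_pos fun i _ => pow_pos (hx0 _) _)
      (Finset.prod_pos fun i _ => Finset.prod_pos fun j hj => ?_)
    exact sub_pos.2 (hx (hI (Finset.mem_Ioi.1 hj)))
  · intro J hJ hlt
    right
    have hcard : (Finset.univ.image J).card < (Finset.Icc (J 0) (J (Fin.last (r + 1)))).card := by
      rw [Finset.card_image_of_injective _ hJ.injective, Nat.card_Icc, Finset.card_fin]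
      omega
    obtain ⟨p, hp, hpJ⟩ := Finset.exists_mem_notMem_of_card_lt_card hcard
    have hpJ' : p ∉ Set.range J := by simpa using hpJ
    rw [Finset.mem_Icc] at hp
    refine ⟨p, lt_of_le_of_ne hp.1 fun h => hpJ' ⟨_, h⟩,
      lt_of_le_of_ne hp.2 fun h => hpJ' ⟨_, h.symm⟩, hpJ', ?_⟩
    intro f m hf _ hfJ h1 h2 I hI
    obtain ⟨J₁, J₂, hJ₁, hJ₂, h⟩ :=
      exchange_plucker (Matrix.of fun i (s : ℕ) => x i ^ s) I hf m
    have hI' := hI.comp (Fin.strictMono_succ)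
    have hpos : 0 < ((Matrix.of fun i (s : ℕ) => x i ^ s).submatrix (I ∘ Fin.succ)
        (fun j => f j.castSucc.succ)).det :=
      ih _ _ hI' (hf.comp (Fin.strictMono_succ.comp Fin.strictMono_castSucc))
    rw [hfJ] at h
    refine pos_of_mul_pos_right ?_ hpos.le
    rw [h]
    exact add_pos (mul_pos (ih _ _ hI' hJ₁) (h1 I hI)) (mul_pos (ih _ _ hI' hJ₂) (h2 I hI))

/-- The kernel `x ^ (i - j) ^ 2`, that is `exp (-σ (i - j) ^ 2)` with `x = exp (-σ)`. It is
polynomial in `x` and equals the identity at `x = 0`. -/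
def gaussKernel (n : ℕ) (x : ℝ) : Matrix (Fin n) (Fin n) ℝ :=
  Matrix.of fun i j => x ^ (((i : ℤ) - (j : ℤ)).natAbs ^ 2)

theorem gaussKernel_zero (n : ℕ) : gaussKernel n 0 = 1 := by
  ext i j
  by_cases h : i = j
  · subst h
    simp [gaussKernel]
  · rw [Matrix.one_apply_ne h]
    simp only [gaussKernel, Matrix.of_apply]
    apply zero_pow
    have : ((i : ℤ) - (j : ℤ)).natAbs ≠ 0 := by
      have : (i : ℕ) ≠ j := fun h' => h (Fin.ext h')
      omega
    positivity

theorem det_gaussKernel_submatrix_pos {n r : ℕ} {x : ℝ} (hx0 : 0 < x) (hx1 : x < 1)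
    {I L : Fin r → Fin n} (hI : StrictMono I) (hL : StrictMono L) :
    0 < ((gaussKernel n x).submatrix I L).det := by
  have hq : 1 < (x ^ 2)⁻¹ := (one_lt_inv₀ (by positivity)).2 (pow_lt_one₀ hx0.le hx1 two_ne_zero)
  -- completing the square turns the kernel into a diagonal scaling of `q ^ (i * j)`, `q = x ^ (-2)`
  have hM : (gaussKernel n x).submatrix I L =
      Matrix.of fun i j => x ^ ((I i : ℕ) ^ 2) * (Matrix.of fun i j => x ^ ((L j : ℕ) ^ 2) *
        ((Matrix.of fun (i : Fin n) (s : ℕ) => ((x ^ 2)⁻¹ ^ (i : ℕ)) ^ s).submatrix I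
          (fun j => (L j : ℕ))) i j : Matrix (Fin r) (Fin r) ℝ) i j := by
    ext i j
    simp only [gaussKernel, Matrix.of_apply, submatrix_apply]
    have h1 : ((I i : ℤ) - (L j : ℤ)).natAbs ^ 2 + 2 * ((I i : ℕ) * (L j : ℕ)) =
        (I i : ℕ) ^ 2 + (L j : ℕ) ^ 2 := by
      zify
      rw [sq_abs]
      ring
    have h2 : ((x ^ 2)⁻¹ ^ (I i : ℕ)) ^ (L j : ℕ) * x ^ (2 * ((I i : ℕ) * (L j : ℕ))) = 1 := by
      rw [← pow_mul, pow_mul x 2, ← mul_pow, inv_mul_cancel₀ (by positivity), one_pow]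
    have h3 := congrArg (x ^ ·) h1
    simp only [pow_add] at h3
    calc x ^ (((I i : ℤ) - (L j : ℤ)).natAbs ^ 2) =
        x ^ (((I i : ℤ) - (L j : ℤ)).natAbs ^ 2) * (((x ^ 2)⁻¹ ^ (I i : ℕ)) ^ (L j : ℕ) *
          x ^ (2 * ((I i : ℕ) * (L j : ℕ)))) := by rw [h2, mul_one]
      _ = _ := by rw [mul_left_comm, h3]; ring
  rw [hM, Matrix.det_mul_column, Matrix.det_mul_row]
  refine mul_pos (Finset.prod_pos fun i _ => by positivity)
    (mul_pos (Finset.prod_pos fun i _ => by positivity) ?_)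
  exact det_pow_pos (fun i j h => pow_lt_pow_right₀ hq h) (fun i => by positivity) r I _ hI
    (fun i j h => hL h)

/-! ### Smoothing with the Gaussian kernel -/

theorem det_gaussKernel_mul {n r : ℕ} (x : ℝ) (Y : Matrix (Fin n) (Fin r) ℝ) (I : Fin r → Fin n) :
    ((gaussKernel n x * Y).submatrix I id).det = ∑ L : Fin r ↪o Fin n,
      ((gaussKernel n x).submatrix I L).det * (Y.submatrix L id).det :=
  Matrix.det_mul_eq_sum_orderEmb ((gaussKernel n x).submatrix I id) Y

theorem det_gaussKernel_mul_nonneg {n r : ℕ} {x : ℝ} (hx0 : 0 < x) (hx1 : x < 1)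
    {Y : Matrix (Fin n) (Fin r) ℝ} (hY : ∀ L, StrictMono L → 0 ≤ (Y.submatrix L id).det)
    {I : Fin r → Fin n} (hI : StrictMono I) :
    0 ≤ ((gaussKernel n x * Y).submatrix I id).det := by
  rw [det_gaussKernel_mul]
  exact Finset.sum_nonneg fun L _ => mul_nonneg
    (det_gaussKernel_submatrix_pos hx0 hx1 hI L.strictMono).le (hY L L.strictMono)

/-- A matrix with linearly independent columns has a nonvanishing maximal minor. -/
theorem exists_det_submatrix_ne_zero {n r : ℕ} {Y : Matrix (Fin n) (Fin r) ℝ}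
    (hY : LinearIndependent ℝ Y.col) : ∃ L : Fin r ↪o Fin n, (Y.submatrix L id).det ≠ 0 := by
  by_contra! h
  have h0 : (Yᵀ * Y).det = 0 := by
    rw [Matrix.det_mul_eq_sum_orderEmb]
    exact Finset.sum_eq_zero fun L _ => by rw [h L, mul_zero]
  have h1 : (Yᵀ * Y).rank = r := by
    rw [Matrix.rank_transpose_mul_self]
    simpa using hY.rank_matrix
  have h2 : IsUnit (Yᵀ * Y) := by
    rw [← Matrix.linearIndependent_cols_iff_isUnit, linearIndependent_iff_card_eq_finrank_span,
      Set.finrank, ← Matrix.rank_eq_finrank_span_cols, h1, Fintype.card_fin]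
  rw [Matrix.isUnit_iff_isUnit_det, h0] at h2
  exact not_isUnit_zero h2

theorem det_gaussKernel_mul_pos {n r : ℕ} {x : ℝ} (hx0 : 0 < x) (hx1 : x < 1)
    {Y : Matrix (Fin n) (Fin r) ℝ} (hY : ∀ L, StrictMono L → 0 ≤ (Y.submatrix L id).det)
    (hind : LinearIndependent ℝ Y.col) {I : Fin r → Fin n} (hI : StrictMono I) :
    0 < ((gaussKernel n x * Y).submatrix I id).det := by
  rw [det_gaussKernel_mul]
  obtain ⟨L₀, hL₀⟩ := exists_det_submatrix_ne_zero hind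
  exact Finset.sum_pos' (fun L _ => mul_nonneg
    (det_gaussKernel_submatrix_pos hx0 hx1 hI L.strictMono).le (hY L L.strictMono))
    ⟨L₀, Finset.mem_univ _, mul_pos (det_gaussKernel_submatrix_pos hx0 hx1 hI L₀.strictMono)
      (lt_of_le_of_ne (hY L₀ L₀.strictMono) hL₀.symm)⟩

/-- Nonnegativity of the smoothed minors passes to the limit `x → 0`. -/
theorem det_nonneg_of_gaussKernel {n r : ℕ} {Y : Matrix (Fin n) (Fin r) ℝ} {I : Fin r → Fin n}
    (h : ∀ x : ℝ, 0 < x → x < 1 → 0 ≤ ((gaussKernel n x * Y).submatrix I id).det) :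
    0 ≤ (Y.submatrix I id).det := by
  have hc : Continuous fun x : ℝ => ((gaussKernel n x * Y).submatrix I id).det := by
    have : Continuous fun x : ℝ => gaussKernel n x := by
      refine continuous_matrix fun i j => ?_
      simp only [gaussKernel, Matrix.of_apply]
      fun_prop
    exact ((this.matrix_mul continuous_const).matrix_submatrix I id).matrix_det
  have h0 : Filter.Tendsto (fun x : ℝ => ((gaussKernel n x * Y).submatrix I id).det)
      (nhdsWithin 0 (Set.Ioi 0)) (nhds (Y.submatrix I id).det) := by
    have := hc.tendsto 0
    rw [gaussKernel_zero, Matrix.one_mul] at this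
    exact this.mono_left nhdsWithin_le_nhds
  refine ge_of_tendsto h0 ?_
  filter_upwards [Ioo_mem_nhdsGT (zero_lt_one' ℝ)] with x hx
  exact h x hx.1 hx.2

/-- One exchange step: from column tuples in which an endpoint is exchanged for the interior
column `p` to the tuple without `p`. Linear independence of `S ∪ {p}` makes the pivot positive after
smoothing. -/
theorem det_nonneg_of_exchange {n r : ℕ} {V : Matrix (Fin n) ℕ ℝ}
    (h : ∀ (I : Fin (r + 1) → Fin n) (J : Fin (r + 1) → ℕ), StrictMono I → StrictMono J →
      0 ≤ (V.submatrix I J).det)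
    {f : Fin (r + 3) → ℕ} (hf : StrictMono f) (m : Fin (r + 1))
    (hind : LinearIndependent ℝ fun j : Fin (r + 1) => V.col (f j.castSucc.succ))
    (h₁ : ∀ I, StrictMono I → 0 ≤ (V.submatrix I (f ∘ Fin.succ)).det)
    (h₂ : ∀ I, StrictMono I → 0 ≤ (V.submatrix I (f ∘ Fin.castSucc)).det)
    {I : Fin (r + 2) → Fin n} (hI : StrictMono I) :
    0 ≤ (V.submatrix I (f ∘ m.castSucc.succ.succAbove)).det := by
  refine det_nonneg_of_gaussKernel (Y := V.submatrix id (f ∘ m.castSucc.succ.succAbove))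
    fun x hx0 hx1 => ?_
  obtain ⟨J₁, J₂, hJ₁, hJ₂, hpl⟩ := exchange_plucker (gaussKernel n x * V) I hf m
  have hI' := hI.comp Fin.strictMono_succ
  have hpos : 0 < ((gaussKernel n x * V).submatrix (I ∘ Fin.succ)
      (fun j => f j.castSucc.succ)).det :=
    det_gaussKernel_mul_pos hx0 hx1 (Y := V.submatrix id fun j => f j.castSucc.succ)
      (fun L hL => h L _ hL (hf.comp (Fin.strictMono_succ.comp Fin.strictMono_castSucc))) hind hI'
  refine nonneg_of_mul_nonneg_right ?_ hpos
  refine hpl.symm ▸ ?_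
  refine add_nonneg (mul_nonneg ?_ ?_) (mul_nonneg ?_ ?_)
  · exact det_gaussKernel_mul_nonneg hx0 hx1 (Y := V.submatrix id J₁)
      (fun L hL => h L _ hL hJ₁) hI'
  · exact det_gaussKernel_mul_nonneg hx0 hx1 (Y := V.submatrix id (f ∘ Fin.succ)) h₁ hI
  · exact det_gaussKernel_mul_nonneg hx0 hx1 (Y := V.submatrix id J₂)
      (fun L hL => h L _ hL hJ₂) hI'
  · exact det_gaussKernel_mul_nonneg hx0 hx1 (Y := V.submatrix id (f ∘ Fin.castSucc)) h₂ hI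

/-! ### Krylov sequences -/

/-- Let `v (s + 1) = T (v s)` and let `U` have dimension at most `r`. If `v c ∉ U`, then any run of
at least `r + 1` indices immediately before `c` contains some `p` with `v p ∉ U`: otherwise the
vectors of the run are dependent, so that a subspace of `U` spanned by the first few of them is
`T`-invariant and contains `v c`. -/
theorem exists_notMem_of_orbit {E : Type*} [AddCommGroup E] [Module ℝ E] [FiniteDimensional ℝ E]
    {T : E →ₗ[ℝ] E} {v : ℕ → E} (hv : ∀ s, v (s + 1) = T (v s)) {a c r : ℕ}
    (hac : a + (r + 1) < c) {U : Submodule ℝ E} (hU : Module.finrank ℝ U ≤ r) (hc : v c ∉ U) :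
    ∃ p, a < p ∧ p < c ∧ v p ∉ U := by
  by_contra! h
  have hli : ∀ m ≤ r + 1, LinearIndependent ℝ fun i : Fin m => v (a + 1 + i) := by
    intro m
    induction m with
    | zero => intro _; exact linearIndependent_empty_type
    | succ m ih =>
      intro hm
      refine linearIndependent_finSucc'.2 ⟨ih (by omega), fun hmem => hc ?_⟩
      set W := Submodule.span ℝ (Set.range fun i : Fin m => v (a + 1 + i)) with hW
      have hmem' : v (a + 1 + m) ∈ W := hmem
      have hWU : W ≤ U := by
        refine Submodule.span_le.2 ?_
        rintro _ ⟨i, rfl⟩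
        exact h _ (by omega) (by omega)
      have hTW : W ≤ W.comap T := by
        refine Submodule.span_le.2 ?_
        rintro _ ⟨i, rfl⟩
        change T (v (a + 1 + i)) ∈ W
        rw [← hv]
        by_cases hi : (i : ℕ) + 1 = m
        · rw [add_assoc, hi]
          exact hmem'
        · exact Submodule.subset_span ⟨⟨i + 1, by omega⟩, rfl⟩
      have hall : ∀ t, v (a + 1 + m + t) ∈ W := by
        intro t
        induction t with
        | zero => exact hmem'
        | succ t iht => rw [← add_assoc, hv]; exact hTW iht
      have := hall (c - (a + 1 + m))
      rw [Nat.add_sub_of_le (by omega)] at this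
      exact hWU this
  have h1 := finrank_span_eq_card (hli (r + 1) le_rfl)
  have h2 : Submodule.span ℝ (Set.range fun i : Fin (r + 1) => v (a + 1 + i)) ≤ U := by
    refine Submodule.span_le.2 ?_
    rintro _ ⟨i, rfl⟩
    exact h _ (by omega) (by omega)
  have h3 := Submodule.finrank_mono h2
  rw [h1, Fintype.card_fin] at h3
  omega

namespace HankelPos

/-- The infinite controllability matrix `(b, A b, A² b, …)`. -/
def krylov {K : ℕ} (A : Matrix (Fin K) (Fin K) ℝ) (b : Fin K → ℝ) : Matrix (Fin K) ℕ ℝ :=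
  Matrix.of fun i s => ((A ^ s).mulVec b) i

theorem krylov_col_succ {K : ℕ} (A : Matrix (Fin K) (Fin K) ℝ) (b : Fin K → ℝ) (s : ℕ) :
    (krylov A b).col (s + 1) = A.mulVec ((krylov A b).col s) := by
  change (A ^ (s + 1)).mulVec b = A.mulVec ((A ^ s).mulVec b)
  rw [pow_succ', Matrix.mulVec_mulVec]

/-- Minors of consecutive columns are minors of `A ^ s * ctrb r A b`. -/
theorem det_krylov_consecutive_nonneg {K r : ℕ} {A : Matrix (Fin K) (Fin K) ℝ} {b : Fin K → ℝ}
    (hA : Nonneg (compound A r)) (hb : Nonneg (compound (ctrb r A b) r)) (s : ℕ)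
    {I : Fin r → Fin K} (hI : StrictMono I) :
    0 ≤ ((krylov A b).submatrix I fun j : Fin r => s + (j : ℕ)).det := by
  induction s generalizing I with
  | zero =>
    have := hb (OrderEmbedding.ofStrictMono I hI) (OrderEmbedding.ofStrictMono id strictMono_id)
    simpa [compound, ctrb, krylov, Matrix.submatrix] using this
  | succ s ih =>
    have h : (krylov A b).submatrix I (fun j : Fin r => s + 1 + (j : ℕ)) =
        A.submatrix I id * (krylov A b).submatrix id (fun j : Fin r => s + (j : ℕ)) := by
      ext i j
      have := congrFun (krylov_col_succ A b (s + j)) (I i)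
      rw [add_right_comm] at this
      exact this
    rw [h, Matrix.det_mul_eq_sum_orderEmb]
    exact Finset.sum_nonneg fun L _ =>
      mul_nonneg (hA (OrderEmbedding.ofStrictMono I hI) L) (ih L.strictMono)

/-- For a `k`-positive `A`, nonnegativity of the minors of the initial columns of the
controllability matrix spreads to all its minors of order at most `k`. -/
theorem det_krylov_nonneg {K k : ℕ} {A : Matrix (Fin K) (Fin K) ℝ} {b : Fin K → ℝ}
    (hA : ∀ j, 1 ≤ j → j ≤ k → Nonneg (compound A j))
    (hb : ∀ j, 1 ≤ j → j ≤ k → Nonneg (compound (ctrb j A b) j)) (r : ℕ) (hr : r ≤ k)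
    (I : Fin r → Fin K) (J : Fin r → ℕ) (hI : StrictMono I) (hJ : StrictMono J) :
    0 ≤ ((krylov A b).submatrix I J).det := by
  induction r with
  | zero => simp
  | succ r ih =>
  cases r with
  | zero =>
    have : J = fun j : Fin 1 => J 0 + (j : ℕ) := by
      funext j; rw [Fin.fin_one_eq_zero j]; rfl
    rw [this]
    exact det_krylov_consecutive_nonneg (hA 1 le_rfl hr) (hb 1 le_rfl hr) _ hI
  | succ r =>
  revert I
  refine spread_induction (P := fun J => ∀ I : Fin (r + 2) → Fin K, StrictMono I →
    0 ≤ ((krylov A b).submatrix I J).det) ?_ ?_ J hJ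
  · intro s I hI
    exact det_krylov_consecutive_nonneg (hA _ (by omega) hr) (hb _ (by omega) hr) s hI
  · intro J hJ hlt
    by_cases hind : LinearIndependent ℝ fun j => (krylov A b).col (J j)
    · right
      -- the interior columns `S` of `J` span a space of dimension at most `r` missing the last one
      set S : Fin r → ℕ := fun j => J j.castSucc.succ with hS
      set U := Submodule.span ℝ (Set.range fun j => (krylov A b).col (S j)) with hUdef
      have hU : Module.finrank ℝ U ≤ r := by
        have := finrank_range_le_card (R := ℝ) fun j => (krylov A b).col (S j)
        rwa [Fintype.card_fin] at this
      have hind1 : LinearIndependent ℝ fun j : Fin (r + 1) => (krylov A b).col (J j.succ) :=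
        hind.comp _ (Fin.succ_injective _)
      have hc : (krylov A b).col (J (Fin.last (r + 1))) ∉ U :=
        (linearIndependent_finSucc'.1 hind1).2
      have hSind : LinearIndependent ℝ fun j => (krylov A b).col (S j) :=
        (linearIndependent_finSucc'.1 hind1).1
      obtain ⟨p, hp0, hp1, hpU⟩ := exists_notMem_of_orbit (T := A.mulVecLin)
        (v := (krylov A b).col) (krylov_col_succ A b) hlt hU hc
      have hpS : p ∉ Set.range S := by
        rintro ⟨j, rfl⟩
        exact hpU (Submodule.subset_span ⟨j, rfl⟩)
      have hpJ : p ∉ Set.range J := by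
        rintro ⟨j, rfl⟩
        induction j using Fin.cases with
        | zero => exact lt_irrefl _ hp0
        | succ j =>
          induction j using Fin.lastCases with
          | last => exact lt_irrefl _ hp1
          | cast j => exact hpS ⟨j, rfl⟩
      refine ⟨p, hp0, hp1, hpJ, fun f m hf hfp hfJ h1 h2 I hI => ?_⟩
      rw [← hfJ]
      refine det_nonneg_of_exchange (fun I J hI hJ => ih (by omega) I J hI hJ) hf m ?_ h1 h2 hI
      set g : Fin (r + 1) → ℕ := fun j => f j.castSucc.succ with hg
      have hgS : g ∘ m.succAbove = S := by
        funext j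
        simp only [hg, hS, Function.comp_apply, ← hfJ]
        rw [Fin.succ_succAbove_succ, Fin.castSucc_succAbove_castSucc]
      have hgm : g m = p := hfp
      have hrange : Set.range g = insert p (Set.range S) := by
        rw [← hgS, ← hgm, Set.range_comp, Fin.range_succAbove, ← Set.image_insert_eq,
          ← Set.image_univ]
        congr 1
        ext j
        simp [em]
      have hSinj : Function.Injective S :=
        (hJ.comp (Fin.strictMono_succ.comp Fin.strictMono_castSucc)).injective
      have hginj : Function.Injective g :=
        (hf.comp (Fin.strictMono_succ.comp Fin.strictMono_castSucc)).injective
      have : LinearIndepOn ℝ (krylov A b).col (Set.range g) := by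
        rw [hrange, linearIndepOn_insert hpS, linearIndepOn_range_iff hSinj]
        refine ⟨hSind, ?_⟩
        rw [← Set.range_comp]
        exact hpU
      exact (linearIndepOn_range_iff hginj _).1 this
    · left
      intro I hI
      by_contra! hneg
      apply hind
      have hdet : IsUnit ((krylov A b).submatrix I J) :=
        (Matrix.isUnit_iff_isUnit_det _).2 (isUnit_iff_ne_zero.2 hneg.ne)
      have hcol := Matrix.linearIndependent_cols_iff_isUnit.2 hdet
      exact LinearIndependent.of_comp (LinearMap.funLeft ℝ ℝ I) hcol

theorem isKPositive_ctrb {K k : ℕ} {A : Matrix (Fin K) (Fin K) ℝ} {b : Fin K → ℝ}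
    (hA : IsKPositive k A)
    (hb : ∀ j, 1 ≤ j → j ≤ k → Nonneg (compound (ctrb j A b) j)) {t : ℕ} (ht : k ≤ t) :
    IsKPositive k (ctrb t A b) := by
  refine ⟨le_min (hA.1.trans (min_le_left _ _)) ht, fun j _ hj I J => ?_⟩
  exact det_krylov_nonneg hA.2 hb j hj I (fun i => (J i : ℕ)) I.strictMono
    fun _ _ h => J.strictMono h

/-! ### Transposition -/

theorem nonneg_compound_transpose {n m r : ℕ} {X : Matrix (Fin n) (Fin m) ℝ} :
    Nonneg (compound X.transpose r) ↔ Nonneg (compound X r) := by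
  have h : ∀ I J, compound X.transpose r I J = compound X r J I := fun I J => by
    simp only [compound, Matrix.of_apply]
    rw [← Matrix.transpose_submatrix, Matrix.det_transpose]
  exact ⟨fun hX I J => h J I ▸ hX J I, fun hX I J => (h I J).symm ▸ hX J I⟩

theorem isKPositive_transpose {n m k : ℕ} {X : Matrix (Fin n) (Fin m) ℝ} :
    IsKPositive k X.transpose ↔ IsKPositive k X := by
  simp only [IsKPositive, nonneg_compound_transpose, min_comm]

theorem obsv_mul_pow_rank {K j e : ℕ} (A : Matrix (Fin K) (Fin K) ℝ) (c : Fin K → ℝ) :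
    (obsv j A c * A ^ e).rank = (A.transpose ^ e * ctrb j A.transpose c).rank := by
  rw [← Matrix.rank_transpose (obsv j A c * A ^ e), Matrix.transpose_mul, obsv,
    Matrix.transpose_transpose, Matrix.transpose_pow]

theorem impulseResponse_transpose {K : ℕ} (A : Matrix (Fin K) (Fin K) ℝ) (b c : Fin K → ℝ) :
    impulseResponse A.transpose c b = impulseResponse A b c := by
  funext t
  cases t with
  | zero => rfl
  | succ t =>
    simp only [impulseResponse]
    rw [← Matrix.transpose_pow, Matrix.mulVec_transpose, dotProduct_comm,
      Matrix.dotProduct_mulVec]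

theorem IsRealization.transpose {K : ℕ} {A : Matrix (Fin K) (Fin K) ℝ} {b c : Fin K → ℝ}
    {G : RatFunc ℝ} (h : IsRealization A b c G) : IsRealization A.transpose c b G := by
  unfold IsRealization
  rw [impulseResponse_transpose]
  exact h

/-! ### Annihilating polynomials and poles -/

open Polynomial in
/-- A polynomial `P` with `P(A) b = 0` clears the denominator of the transfer function: `P G` has
vanishing coefficients `∑ᵢ Pᵢ c Aᵗ⁺ⁱ b` at all negative powers of `z`, hence is a polynomial. -/
theorem IsRealization.denom_dvd {K : ℕ} {A : Matrix (Fin K) (Fin K) ℝ} {b c : Fin K → ℝ}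
    {G : RatFunc ℝ} (h : IsRealization A b c G) {P : ℝ[X]} (hP : (aeval A P).mulVec b = 0) :
    G.denom.map (algebraMap ℝ ℂ) ∣ P.map (algebraMap ℝ ℂ) := by
  set g := impulseResponse A b c with hg
  let Q : ℕ → ℂ[X] := fun i => Nat.rec 0 (fun i q => X * q + C (g (i + 1) : ℂ)) i
  have hQ : ∀ i, Q (i + 1) = X * Q i + C (g (i + 1) : ℂ) := fun _ => rfl
  have hann : ∀ t, ∑ i ∈ range (P.natDegree + 1), P.coeff i * g (t + 1 + i) = 0 := by
    intro t
    have : c ⬝ᵥ (A ^ t).mulVec ((aeval A P).mulVec b) = 0 := by rw [hP]; simp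
    rw [aeval_eq_sum_range, Matrix.sum_mulVec, Matrix.mulVec_sum, dotProduct_sum] at this
    rw [← this]
    refine Finset.sum_congr rfl fun i _ => ?_
    rw [hg, add_right_comm]
    simp only [impulseResponse]
    rw [Matrix.smul_mulVec, Matrix.mulVec_smul, Matrix.mulVec_mulVec, ← pow_add,
      dotProduct_smul, smul_eq_mul]
  -- `Q i` is the polynomial part of `zⁱ G`, so that `R` is the polynomial part of `P G`
  set R : ℂ[X] := ∑ i ∈ range (P.natDegree + 1), C (P.coeff i : ℂ) * Q i with hR
  have hfin : ∀ᶠ z : ℂ in Bornology.cobounded ℂ,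
      (G.denom.map (algebraMap ℝ ℂ)).eval z ≠ 0 := by
    have hne : G.denom.map (algebraMap ℝ ℂ) ≠ 0 :=
      (Polynomial.map_ne_zero_iff (algebraMap ℝ ℂ).injective).2 G.denom_ne_zero
    have := (G.denom.map (algebraMap ℝ ℂ)).rootSet_finite ℂ
    have hb := Bornology.isBounded_def.1 this.isBounded
    filter_upwards [hb] with z hz h0
    apply hz
    rw [mem_rootSet]
    exact ⟨hne, by simpa using h0⟩
  have hz0 : ∀ᶠ z : ℂ in Bornology.cobounded ℂ, z ≠ 0 := by
    have := Bornology.isBounded_def.1 (Set.finite_singleton (0 : ℂ)).isBounded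
    filter_upwards [this] with z hz using hz
  have hev : ∀ᶠ z : ℂ in Bornology.cobounded ℂ,
      (P.map (algebraMap ℝ ℂ) * G.num.map (algebraMap ℝ ℂ)).eval z =
        (R * G.denom.map (algebraMap ℝ ℂ)).eval z := by
    filter_upwards [h, hfin, hz0] with z hz hden hz0
    set Gz := RatFunc.eval (algebraMap ℝ ℂ) z G with hGz
    -- the tails of the series, shifted back to start at `z⁻¹`
    have hshift : ∀ i, HasSum (fun t : ℕ => (g (t + 1 + i) : ℂ) * (z ^ (t + 1))⁻¹)
        (z ^ i * Gz - (Q i).eval z) := by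
      intro i
      induction i with
      | zero =>
        have := (hasSum_nat_add_iff' 1).2 hz
        simpa [Q, hg, impulseResponse] using this
      | succ i ih =>
        have := ((hasSum_nat_add_iff' 1).2 ih).mul_left z
        have e1 : (fun t : ℕ => (g (t + 1 + (i + 1)) : ℂ) * (z ^ (t + 1))⁻¹) =
            fun t => z * ((g (t + 1 + 1 + i) : ℂ) * (z ^ (t + 1 + 1))⁻¹) := by
          funext t
          have e : t + 1 + (i + 1) = t + 1 + 1 + i := by ring
          rw [e]
          field_simp
          ring
        have e2 : z ^ (i + 1) * Gz - (Q (i + 1)).eval z = z * (z ^ i * Gz - (Q i).eval z -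
            ∑ t ∈ range 1, (g (t + 1 + i) : ℂ) * (z ^ (t + 1))⁻¹) := by
          rw [hQ]
          simp only [Finset.sum_range_one, eval_add, eval_mul, eval_X, eval_C, zero_add, pow_one]
          rw [add_comm 1 i]
          field_simp
          ring
        rw [e1, e2]
        exact this
    have hsum := hasSum_sum (s := range (P.natDegree + 1)) fun i _ =>
      (hshift i).mul_left (P.coeff i : ℂ)
    have hzero : (fun t : ℕ => ∑ i ∈ range (P.natDegree + 1),
        (P.coeff i : ℂ) * ((g (t + 1 + i) : ℂ) * (z ^ (t + 1))⁻¹)) = fun _ => 0 := by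
      funext t
      have := congrArg (fun x : ℝ => (x : ℂ) * (z ^ (t + 1))⁻¹) (hann t)
      simpa [Finset.sum_mul, mul_assoc] using this
    rw [hzero] at hsum
    have key := hsum.unique hasSum_zero
    simp only [mul_sub, Finset.sum_sub_distrib] at key
    have hPz : (P.map (algebraMap ℝ ℂ)).eval z * Gz = R.eval z := by
      rw [hR, eval_finsetSum, Polynomial.eval_map, eval₂_eq_sum_range, Finset.sum_mul]
      simp only [eval_mul, eval_C]
      rw [← sub_eq_zero, ← key]
      simp only [Complex.coe_algebraMap, mul_assoc]
    have hGd : Gz * (G.denom.map (algebraMap ℝ ℂ)).eval z =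
        (G.num.map (algebraMap ℝ ℂ)).eval z := by
      rw [hGz, RatFunc.eval, ← Polynomial.eval_map, ← Polynomial.eval_map]
      exact div_mul_cancel₀ _ hden
    rw [eval_mul, eval_mul, ← hGd, ← hPz, mul_assoc]
  have hinf : Set.Infinite {z : ℂ |
      (P.map (algebraMap ℝ ℂ) * G.num.map (algebraMap ℝ ℂ)).eval z =
        (R * G.denom.map (algebraMap ℝ ℂ)).eval z} := by
    intro hf
    have h1 := Bornology.isBounded_def.1 hf.isBounded
    have h2 := Filter.inter_mem hev h1
    rw [Set.inter_compl_self] at h2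
    exact Filter.empty_notMem _ h2
  have heq := Polynomial.eq_of_infinite_eval_eq _ _ hinf
  have hcop : IsCoprime (G.denom.map (algebraMap ℝ ℂ)) (G.num.map (algebraMap ℝ ℂ)) :=
    (RatFunc.isCoprime_num_denom G).symm.map (Polynomial.mapRingHom (algebraMap ℝ ℂ))
  exact hcop.dvd_of_dvd_mul_right (heq ▸ dvd_mul_left _ _)

open Polynomial in
/-- If `A ^ e * ctrb j A b` is rank deficient, then `G` has fewer than `j` nonzero poles. -/
theorem IsRealization.card_poles_ne_zero_lt {K : ℕ} {A : Matrix (Fin K) (Fin K) ℝ}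
    {b c : Fin K → ℝ} {G : RatFunc ℝ} (h : IsRealization A b c G) {e j : ℕ}
    (hrank : (A ^ e * ctrb j A b).rank ≠ j) : ((poles G).filter (· ≠ 0)).card < j := by
  obtain ⟨u, hu, hu0⟩ : ∃ u : Fin j → ℝ, (A ^ e * ctrb j A b).mulVec u = 0 ∧ u ≠ 0 := by
    by_contra! hinj
    apply hrank
    rw [Matrix.rank, LinearMap.finrank_range_of_inj]
    · simp
    · rw [← LinearMap.ker_eq_bot, LinearMap.ker_eq_bot']
      exact hinj
  set q : ℝ[X] := ∑ i : Fin j, C (u i) * X ^ (i : ℕ) with hq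
  have hcoeff : ∀ i : Fin j, q.coeff i = u i := by
    intro i
    simp [hq, Polynomial.coeff_C_mul, Polynomial.coeff_X_pow,
      ← Fin.ext_iff]
  have hq0 : q ≠ 0 := by
    rintro h0
    apply hu0
    funext i
    rw [← hcoeff, h0]
    simp
  have hdeg : q.natDegree < j := (Polynomial.natDegree_lt_iff_degree_lt hq0).2
    (Polynomial.degree_sum_fin_lt u)
  have hann : (aeval A (X ^ e * q)).mulVec b = 0 := by
    rw [← hu, map_mul, ← Matrix.mulVec_mulVec, ← Matrix.mulVec_mulVec, map_pow, aeval_X]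
    congr 1
    rw [hq, map_sum, Matrix.sum_mulVec]
    funext i
    simp only [Finset.sum_apply, Matrix.mulVec, dotProduct, ctrb, Matrix.of_apply]
    refine Finset.sum_congr rfl fun l _ => ?_
    rw [map_mul, map_pow, aeval_C, aeval_X, ← Algebra.smul_def]
    simp only [Matrix.smul_apply, smul_eq_mul, mul_assoc]
    rw [← Finset.mul_sum, mul_comm]
  have hmap0 : (X ^ e * q).map (algebraMap ℝ ℂ) ≠ 0 :=
    (Polynomial.map_ne_zero_iff (algebraMap ℝ ℂ).injective).2
      (mul_ne_zero (pow_ne_zero _ X_ne_zero) hq0)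
  have hle : poles G ≤ ((X ^ e * q).map (algebraMap ℝ ℂ)).roots :=
    Polynomial.roots.le_of_dvd hmap0 (h.denom_dvd hann)
  refine lt_of_le_of_lt (Multiset.card_le_card (Multiset.filter_le_filter _ hle)) ?_
  have hroots : ((X ^ e * q).map (algebraMap ℝ ℂ)).roots =
      e • {0} + (q.map (algebraMap ℝ ℂ)).roots := by
    rw [Polynomial.map_mul, Polynomial.map_pow, Polynomial.map_X] at hmap0 ⊢
    rw [Polynomial.roots_mul hmap0, Polynomial.roots_X_pow]
  have hnil : (e • ({0} : Multiset ℂ)).filter (· ≠ 0) = 0 := by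
    rw [Multiset.filter_eq_nil]
    intro x hx
    rw [Multiset.nsmul_singleton] at hx
    simp [Multiset.eq_of_mem_replicate hx]
  rw [hroots, Multiset.filter_add, hnil, zero_add]
  calc _ ≤ (q.map (algebraMap ℝ ℂ)).roots.card := Multiset.card_le_card (Multiset.filter_le _ _)
    _ ≤ (q.map (algebraMap ℝ ℂ)).natDegree := Polynomial.card_roots' _
    _ ≤ q.natDegree := Polynomial.natDegree_map_le
    _ < j := hdeg

/-- The poles listed no later than a nonzero one are nonzero. -/
theorem IsPoleListing.succ_le_card_poles_ne_zero {G : RatFunc ℝ} {p : Fin (order G) → ℂ}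
    (hp : IsPoleListing G p) {i : Fin (order G)} (hi : p i ≠ 0) :
    (i : ℕ) + 1 ≤ ((poles G).filter (· ≠ 0)).card := by
  rw [← hp.1, Multiset.filter_map, Multiset.card_map]
  have : (Finset.Iic i).card ≤ (Finset.univ.filter fun l => p l ≠ 0).card := by
    refine Finset.card_le_card fun l hl => ?_
    rw [Finset.mem_filter]
    refine ⟨Finset.mem_univ _, ?_⟩
    rcases (Finset.mem_Iic.1 hl).eq_or_lt with rfl | hlt
    · exact hi
    · have h0 : 0 < ‖p i‖ := norm_pos_iff.2 hi
      rcases hp.2 l i hlt with h | h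
      · exact norm_pos_iff.1 (h0.trans h)
      · exact norm_pos_iff.1 (h.1 ▸ h0)
  rwa [Fin.card_Iic] at this

/-- A nonzero pole `p_{k-1}` forces `A ^ e * ctrb j A b` to have full column rank for `j ≤ k - 1`,
whatever the exponent `e`. -/
theorem IsRealization.rank_eq {K : ℕ} {A : Matrix (Fin K) (Fin K) ℝ}
    {b c : Fin K → ℝ} {G : RatFunc ℝ} (h : IsRealization A b c G) {k : ℕ} (hk : k ≤ order G)
    {p : Fin (order G) → ℂ} (hp : IsPoleListing G p)
    (hpos : ∀ i : Fin (order G), (i : ℕ) + 1 = k - 1 → (p i).im = 0 ∧ 0 < (p i).re)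
    {e j : ℕ} (hj1 : 1 ≤ j) (hj : j ≤ k - 1) : (A ^ e * ctrb j A b).rank = j := by
  by_contra hrank
  have h1 := h.card_poles_ne_zero_lt hrank
  have hk2 : 1 ≤ k - 1 := hj1.trans hj
  have hi : k - 2 < order G := by omega
  have hne : p ⟨k - 2, hi⟩ ≠ 0 := by
    intro h0
    have := (hpos ⟨k - 2, hi⟩ (by simp only; omega)).2
    rw [h0] at this
    simp at this
  have h2 := hp.succ_le_card_poles_ne_zero hne
  simp only at h2
  omega

end HankelPos

end

theorem mainTheorem1 {K : ℕ} (k : ℕ) (hk : 1 ≤ k)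
    (A : Matrix (Fin K) (Fin K) ℝ) (b c : Fin K → ℝ) (G : RatFunc ℝ)
    (hG : HankelPos.IsRealization A b c G) (hA : HankelPos.IsKPositive k A) :
    ((∀ j, 1 ≤ j → j ≤ k → HankelPos.Nonneg (HankelPos.compound (HankelPos.ctrb j A b) j)) →
      (∀ j, 1 ≤ j → j ≤ k - 1 → (A ^ (K - j) * HankelPos.ctrb j A b).rank = j) →
      ∀ t, k ≤ t → HankelPos.IsKPositive k (HankelPos.ctrb t A b)) ∧
    ((∀ j, 1 ≤ j → j ≤ k → HankelPos.Nonneg (HankelPos.compound (HankelPos.obsv j A c) j)) →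
      (∀ j, 1 ≤ j → j ≤ k - 1 → (HankelPos.obsv j A c * A ^ (K - j)).rank = j) →
      ∀ t, k ≤ t → HankelPos.IsKPositive k (HankelPos.obsv t A c)) ∧
    (k ≤ HankelPos.order G →
      ∀ p : Fin (HankelPos.order G) → ℂ, HankelPos.IsPoleListing G p →
      (∀ i : Fin (HankelPos.order G), (i : ℕ) + 1 = k - 1 → (p i).im = 0 ∧ 0 < (p i).re) →
      (∀ j, 1 ≤ j → j ≤ k - 1 → (A ^ (K - j) * HankelPos.ctrb j A b).rank = j) ∧
      (∀ j, 1 ≤ j → j ≤ k - 1 → (HankelPos.obsv j A c * A ^ (K - j)).rank = j)) := by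
  refine ⟨fun hb _ t ht => HankelPos.isKPositive_ctrb hA hb ht, fun hc _ t ht => ?_,
    fun hn p hp hpos => ⟨fun j hj1 hj => hG.rank_eq hn hp hpos hj1 hj, fun j hj1 hj => ?_⟩⟩
  · refine HankelPos.isKPositive_transpose.2 (HankelPos.isKPositive_ctrb
      (HankelPos.isKPositive_transpose.2 hA) (fun j h1 h2 => ?_) ht)
    exact HankelPos.nonneg_compound_transpose.1 (hc j h1 h2)
  · rw [HankelPos.obsv_mul_pow_rank]
    exact hG.transpose.rank_eq hn hp hpos hj1 hj
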